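/- Let $L/K$ be a finite Galois CM-extension of number fields with Galois group $G$ (so $K$ is totally real, $L$ is a CM-field, and complex conjugation gives an element $j\in G$). **Notation.** For each finite place $v$ of $K$ fix a place $w$ of $L$ above $v$, with inertia group $I_w\le G_w\le G$ and a lift $\phi_w\in G_w$ of the Frobenius automorphism; $N(v)$ is the cardinality of the residue field at $v$. Let $S_\infty$ and $S_{\mathrm{ram}}$ be the sets of archimedean places of $K$ and of places of $K$ ramified in $L$. For a ring $R$ let $\zeta(R)$ be its centre, and identify $\zeta(\mathbb C[G])=\prod_{\chi\in \mathrm{Irr}_{\mathbb C}(G)}\mathbb C$. For a finite set $S\supseteq S_{\mathrm{ram}}\cup S_\infty$ of places of $K$, let $L_S(s,\chi)$ be the meromorphic continuation of $\prod_{v\notin S}\det(1-N(v)^{-s}\phi_w\mid V_\chi^{I_w})^{-1}$ ($\mathrm{Re}(s)>1$), which is holomorphic at $s=0$, and let $\theta_S=(L_S(0,\check\chi))_\chi\in\zeta(\mathbb C[G])$, where $\check\chi$ is the contragredient of $\chi$. For a finite set $T$ of finite places of $K$ let $\delta_T(0)=\bigl(\prod_{v\in T}\det(1-N(v)\phi_w^{-1}\mid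 V_\chi^{I_w})\bigr)_\chi$. Let $E_{L,S}^T$ be the group of all $x\in L^\times$ that are units at every finite place of $L$ not above $S$ and satisfy $x\equiv1$ modulo every prime of $L$ above $T$. Say that $\mathrm{Hyp}(S,T)$ holds if $S\supseteq S_{\mathrm{ram}}\cup S_\infty$, $S\cap T=\emptyset$ and $E_{L,S}^T$ is torsion-free. Let $\mathfrak A_S$ be the $\zeta(\mathbb Z[G])$-module generated by all $\delta_T(0)$ with $\mathrm{Hyp}(S,T)$. Let $\mathrm{nr}$ be the reduced norm on matrices over $\mathbb Q[G]$, and for a square matrix $H$ over $\mathbb Z[G]$ let $H^*$ be its generalised adjoint (in each Wedderburn component over $\mathbb C$ it is the adjugate matrix, so that $H^*H=HH^*=\mathrm{nr}(H)\cdot 1$). Put $$\mathcal H(G)=\{x\in\zeta(\mathbb Z[G]) : xH^*\in M_{n\times n}(\mathbb Z[G])\ \text{for all } n \text{ and all } H\in M_{n\times n}(\mathbb Z[G])\}.$$ For a maximal order $\mathfrak M$ with $\mathbb Z[G]\subseteq\mathfrak M\subseteq\mathbb Q[G]$, put $\mathcal F(G)=\{x\in\zeta(\mathfrak M): x\mathfrak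 M\subseteq\mathbb Z[G]\}$. Let $\mu_L$ be the group of roots of unity and $\mathrm{cl}_L$ the class group of $L$, and $\omega_L=\mathrm{nr}(|\mu_L|)$. An anti-unit is an $\epsilon\in L^\times$ with $\epsilon^{1+j}=1$. For $\epsilon\in L^\times$ let $S_\epsilon$ be the set of finite places of $K$ lying below a prime ideal of $L$ that occurs with non-zero exponent in the factorisation of $(\epsilon)$. **Conjectures.** $B(L/K,S)$: for each $x\in\mathcal H(G)$ one has $x\,\mathfrak A_S\theta_S\subseteq\mathrm{Ann}_{\zeta(\mathbb Z[G])}(\mathrm{cl}_L)$. $BS(L/K,S)$: for each $x\in\mathcal H(G)$ one has $x\,\omega_L\theta_S\in\zeta(\mathbb Z[G])$, and for each non-zero fractional ideal $\mathfrak a$ of $L$ there is an anti-unit $\epsilon\in L^\times$ such that $\mathfrak a^{x\omega_L\theta_S}=(\epsilon)$ and, for each finite set $T$ of primes of $K$ with $\mathrm{Hyp}(S\cup S_\epsilon,T)$, there is an $\epsilon_T\in E_{L,S_\epsilon}^T$ with $\epsilon^{z\delta_T(0)}=\epsilon_T^{z\omega_L}$ for each $z\in\mathcal H(G)$. $B_w(L/K,S)$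 and $BS_w(L/K,S)$ are the same statements with $\mathcal H(G)$ replaced everywhere by $\mathcal F(G)$. **Lemma.** Let $S\subseteq S'$ be finite sets of places of $K$ such that $S\supseteq S_{\mathrm{ram}}\cup S_\infty$. Then $$B(L/K,S)\Rightarrow B(L/K,S'),\qquad B_w(L/K,S)\Rightarrow B_w(L/K,S'),$$ $$BS(L/K,S)\Rightarrow BS(L/K,S'),\qquad BS_w(L/K,S)\Rightarrow BS_w(L/K,S').$$ -/

import Mathlib

open NumberField IsDedekindDomain
open scoped Pointwise nonZeroDivisors

noncomputable section

namespace BrumerStark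

/-! ### The Wedderburn decomposition, reduced norms and generalised adjoints -/

section Algebra

variable (G : Type*) [Group G] [Finite G]

/-- A Wedderburn decomposition of `ℂ[G]`: an isomorphism with a finite product of matrix algebras.
The factors are indexed by the irreducible complex characters `χ` of `G`, and `dim χ = χ(1)`. -/
structure WedderburnDecomposition where
  card : ℕ
  dim : Fin card → ℕ
  dim_ne_zero : ∀ i, NeZero (dim i)
  iso : MonoidAlgebra ℂ G ≃ₐ[ℂ] ((i : Fin card) → Matrix (Fin (dim i)) (Fin (dim i)) ℂ)

theorem nonempty_wedderburnDecomposition : Nonempty (WedderburnDecomposition G) := by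
  obtain ⟨n, d, hd, ⟨e⟩⟩ :=
    IsSemisimpleRing.exists_algEquiv_pi_matrix_of_isAlgClosed ℂ (MonoidAlgebra ℂ G)
  exact ⟨⟨n, d, hd, e⟩⟩

/-- A fixed Wedderburn decomposition of `ℂ[G]`. (Everything below is independent of the choice,
because any two choices differ by a permutation of the factors and inner automorphisms.) -/
def wedderburn : WedderburnDecomposition G :=
  Classical.choice (nonempty_wedderburnDecomposition G)

/-- The index set for the irreducible complex characters of `G`. -/
abbrev Irr : Type := Fin (wedderburn G).card

variable {G}

/-- The degree `χ(1)`. -/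
abbrev Irr.degree (χ : Irr G) : ℕ := (wedderburn G).dim χ

/-- The projection of `ℂ[G]` to the matrix algebra belonging to `χ`. -/
def Irr.proj (χ : Irr G) : MonoidAlgebra ℂ G →ₐ[ℂ] Matrix (Fin χ.degree) (Fin χ.degree) ℂ :=
  (Pi.evalAlgHom ℂ (fun χ : Irr G => Matrix (Fin χ.degree) (Fin χ.degree) ℂ) χ).comp
    (wedderburn G).iso.toAlgHom

/-- The irreducible representation `V_χ` of `G` with character `χ`. -/
def Irr.rep (χ : Irr G) : Representation ℂ G (Fin χ.degree → ℂ) :=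
  ((Matrix.toLinAlgEquiv' : Matrix (Fin χ.degree) (Fin χ.degree) ℂ ≃ₐ[ℂ] _).toAlgHom.comp
    χ.proj : MonoidAlgebra ℂ G →* Module.End ℂ (Fin χ.degree → ℂ)).comp (MonoidAlgebra.of ℂ G)

/-- The element of the centre `ζ(ℂ[G]) = ∏_χ ℂ` with the given components. -/
def centralElement (c : Irr G → ℂ) : MonoidAlgebra ℂ G :=
  (wedderburn G).iso.symm fun χ => Matrix.scalar (Fin ((wedderburn G).dim χ)) (c χ)

/-- The image in `M_{n χ(1)}(ℂ)` of a matrix `H ∈ M_n(ℂ[G])`. -/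
def component (χ : Irr G) {n : ℕ} (H : Matrix (Fin n) (Fin n) (MonoidAlgebra ℂ G)) :
    Matrix (Fin n × Fin χ.degree) (Fin n × Fin χ.degree) ℂ :=
  Matrix.comp _ _ _ _ _ (H.map χ.proj)

/-- The reduced norm `nr(H)` of a matrix over `ℂ[G]`, computed component-wise on the Wedderburn
decomposition. On matrices over `ℚ[G]` it is the reduced norm of the `ℚ`-algebra `ℚ[G]`, since
reduced norms are compatible with extension of scalars. -/
def nrMatrix {n : ℕ} (H : Matrix (Fin n) (Fin n) (MonoidAlgebra ℂ G)) : MonoidAlgebra ℂ G :=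
  centralElement fun χ => (component χ H).det

/-- The reduced norm of an element. -/
def nr (x : MonoidAlgebra ℂ G) : MonoidAlgebra ℂ G :=
  nrMatrix (Matrix.diagonal fun _ : Fin 1 => x)

/-- The generalised adjoint matrix `H*`: its component at each `χ` is the adjugate of the component
of `H` at `χ`. Equivalently, at each `χ` it is `(-1)^(m+1) ∑_{j ≥ 1} α_j H^(j-1)`, where
`∑_j α_j X^j` is the reduced characteristic polynomial, of degree `m`.
In particular `H* H = H H* = nr(H)`. -/
def genAdjoint {n : ℕ} (H : Matrix (Fin n) (Fin n) (MonoidAlgebra ℂ G)) :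
    Matrix (Fin n) (Fin n) (MonoidAlgebra ℂ G) :=
  Matrix.of fun a b => (wedderburn G).iso.symm fun χ =>
    Matrix.of fun k l => (component χ H).adjugate (a, k) (b, l)

variable (G)

/-- The inclusion `ℤ[G] ⊆ ℂ[G]`. -/
def intIncl : MonoidAlgebra ℤ G →+* MonoidAlgebra ℂ G :=
  MonoidAlgebra.mapRingHom G (Int.castRingHom ℂ)

/-- The inclusion `ℤ[G] ⊆ ℚ[G]`. -/
def intInclRat : MonoidAlgebra ℤ G →+* MonoidAlgebra ℚ G :=
  MonoidAlgebra.mapRingHom G (Int.castRingHom ℚ)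

/-- The inclusion `ℚ[G] ⊆ ℂ[G]`. -/
def ratIncl : MonoidAlgebra ℚ G →+* MonoidAlgebra ℂ G :=
  MonoidAlgebra.mapRingHom G (algebraMap ℚ ℂ)

/-- The centre `ζ(ℤ[G])`, as a subring of `ℂ[G]`. -/
def intCenter : Subring (MonoidAlgebra ℂ G) :=
  (Subring.center (MonoidAlgebra ℤ G)).map (intIncl G)

/-- The denominator ideal `𝓗(G)`, as a subset of `ℂ[G]`: all `x ∈ ζ(ℤ[G])` such that
`x H*` has entries in `ℤ[G]` for every square matrix `H` over `ℤ[G]`. -/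
def denominatorIdeal : Set (MonoidAlgebra ℂ G) :=
  {x | x ∈ intCenter G ∧ ∀ (n : ℕ) (H : Matrix (Fin n) (Fin n) (MonoidAlgebra ℤ G)) (a b : Fin n),
    x * genAdjoint (H.map (intIncl G)) a b ∈ (intIncl G).range}

variable {G}

/-- A (`ℤ`-)order in `ℚ[G]`: a subring which is a full `ℤ`-lattice. -/
structure IsOrder (Λ : Subring (MonoidAlgebra ℚ G)) : Prop where
  fg : Λ.toAddSubgroup.FG
  full : ∀ a : MonoidAlgebra ℚ G, ∃ n : ℤ, n ≠ 0 ∧ n • a ∈ Λ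

/-- `𝔐` is a maximal order in `ℚ[G]` that contains `ℤ[G]`. -/
structure IsMaximalOrderOver (𝔐 : Subring (MonoidAlgebra ℚ G)) : Prop where
  maximal : Maximal IsOrder 𝔐
  le : (intInclRat G).range ≤ 𝔐

/-- The central conductor `𝓕(G) = {x ∈ ζ(𝔐) | x 𝔐 ⊆ ℤ[G]}` of `𝔐` over `ℤ[G]`, as a subset of
`ℂ[G]`. -/
def centralConductor (𝔐 : Subring (MonoidAlgebra ℚ G)) : Set (MonoidAlgebra ℂ G) :=
  ratIncl G '' {x | x ∈ 𝔐 ∧ (∀ m ∈ 𝔐, x * m = m * x) ∧ ∀ m ∈ 𝔐, x * m ∈ (intInclRat G).range}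

/-- For an abelian group `M` written multiplicatively with an action `act` of `G`, the result
`m ^ u = ∏_g (g m) ^ (u_g)` of the action of `u = ∑_g u_g g ∈ ℤ[G]` on `m ∈ M`. -/
def groupRingPow {M : Type*} [CommGroup M] (act : G → M →* M) (m : M)
    (u : MonoidAlgebra ℤ G) : M :=
  u.coeff.prod fun g k => act g m ^ k

end Algebra

/-! ### Places, Frobenius elements, units -/

section Arithmetic

/-- The places of a number field. -/
abbrev Place (K : Type*) [Field K] [NumberField K] : Type _ :=
  HeightOneSpectrum (𝓞 K) ⊕ InfinitePlace K

variable (K L : Type*) [Field K] [NumberField K] [Field L] [NumberField L] [Algebra K L]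

/-- The set `S_∞` of archimedean places of `K`. -/
def archimedeanPlaces : Set (Place K) := Set.range Sum.inr

/-- The set `S_ram` of places of `K` that ramify in `L`. -/
def ramifiedPlaces : Set (Place K) :=
  Sum.inl '' {v | ∃ w : HeightOneSpectrum (𝓞 L),
    w.asIdeal.LiesOver v.asIdeal ∧ w.asIdeal.ramificationIdx (𝓞 K) ≠ 1} ∪
  Sum.inr '' {v | ¬ v.IsUnramifiedIn L}

variable {K}

theorem exists_placeAbove (v : HeightOneSpectrum (𝓞 K)) :
    ∃ w : HeightOneSpectrum (𝓞 L), w.asIdeal.LiesOver v.asIdeal := by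
  have := v.isMaximal
  obtain ⟨Q, hQ, hv⟩ :=
    Ideal.exists_maximal_ideal_liesOver_of_isIntegral (S := 𝓞 L) v.asIdeal
  exact ⟨⟨Q, hQ.isPrime, Ideal.ne_bot_of_liesOver_of_ne_bot v.ne_bot Q⟩, hv⟩

/-- A fixed place `w` of `L` above the finite place `v` of `K`. -/
def placeAbove (v : HeightOneSpectrum (𝓞 K)) : HeightOneSpectrum (𝓞 L) :=
  (exists_placeAbove L v).choose

/-- The decomposition group `G_w` of the chosen place `w` above `v`. -/
abbrev decompositionGroup (v : HeightOneSpectrum (𝓞 K)) : Subgroup Gal(L/K) :=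
  MulAction.stabilizer Gal(L/K) (placeAbove L v).asIdeal

/-- The inertia group `I_w`, as a (normal) subgroup of `G_w`. -/
abbrev inertiaGroup (v : HeightOneSpectrum (𝓞 K)) : Subgroup (decompositionGroup L v) :=
  (placeAbove L v).asIdeal.inertia (decompositionGroup L v)

/-- A lift `φ_w ∈ G_w` of the (arithmetic) Frobenius automorphism at `w`. -/
def frobenius [IsGalois K L] (v : HeightOneSpectrum (𝓞 K)) : decompositionGroup L v :=
  ⟨arithFrobAt (𝓞 K) Gal(L/K) (placeAbove L v).asIdeal,
    IsArithFrobAt.arithFrobAt_mem_stabilizer (𝓞 K) Gal(L/K) (placeAbove L v).asIdeal⟩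

variable {L}

/-- `det(1 - u σ | V^{I_w})` for `σ ∈ G_w` and a representation `V` of the Galois group. -/
def detOnInertiaInvariants {V : Type*} [AddCommGroup V] [Module ℂ V]
    (ρ : Representation ℂ Gal(L/K) V) (v : HeightOneSpectrum (𝓞 K))
    (σ : decompositionGroup L v) (u : ℂ) : ℂ :=
  LinearMap.det (1 - u • Representation.toInvariants
    (ρ.comp (decompositionGroup L v).subtype) (inertiaGroup L v) σ)

/-- The cardinality `N(v)` of the residue field at `v`. -/
def placeNorm (v : HeightOneSpectrum (𝓞 K)) : ℕ := Ideal.absNorm v.asIdeal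

/-- `f` is the `S`-truncated Artin `L`-function of the representation `ρ`: a meromorphic function
on `ℂ` which is given for `Re(s) > 1` by the convergent Euler product
`∏_{v ∉ S} det(1 - N(v)^{-s} φ_w | V^{I_w})⁻¹`. -/
structure IsArtinLFunction [IsGalois K L] (S : Set (Place K)) {V : Type*} [AddCommGroup V]
    [Module ℂ V] (ρ : Representation ℂ Gal(L/K) V) (f : ℂ → ℂ) : Prop where
  meromorphic : Meromorphic f
  hasProd : ∀ s : ℂ, 1 < s.re →
    HasProd (fun v : {v : HeightOneSpectrum (𝓞 K) // Sum.inl v ∉ S} =>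
      (detOnInertiaInvariants ρ v.1 (frobenius L v.1) ((placeNorm v.1 : ℂ) ^ (-s)))⁻¹) (f s)

/-- `θ` is the Stickelberger element `θ_S = L_S(0)^♯ ∈ ζ(ℂ[G])`: for each irreducible character
`χ` of `G`, the `L`-function `L_S(s, χ̌)` of the contragredient of `χ` is holomorphic at `s = 0`, and
the `χ`-component of `θ` is its value there. -/
def IsStickelbergerElement [IsGalois K L] (S : Set (Place K)) (θ : MonoidAlgebra ℂ Gal(L/K)) :
    Prop :=
  ∃ c : Irr Gal(L/K) → ℂ, θ = centralElement c ∧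
    ∀ χ : Irr Gal(L/K), ∃ f : ℂ → ℂ,
      IsArtinLFunction S χ.rep.dual f ∧ AnalyticAt ℂ f 0 ∧ c χ = f 0

variable (L) in
/-- `δ_T(s)`, with `χ`-component `∏_{v ∈ T} det(1 - N(v)^{1-s} φ_w⁻¹ | V_χ^{I_w})`. -/
def delta [IsGalois K L] (T : Finset (HeightOneSpectrum (𝓞 K))) (s : ℂ) :
    MonoidAlgebra ℂ Gal(L/K) :=
  centralElement fun χ => ∏ v ∈ T,
    detOnInertiaInvariants χ.rep v (frobenius L v)⁻¹ ((placeNorm v : ℂ) ^ (1 - s))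

variable (L) in
/-- The finite places in `S(L)`: those of `L` above a place in `S`. -/
def finitePlacesAbove (S : Set (Place K)) : Set (HeightOneSpectrum (𝓞 L)) :=
  {w | ∃ v : HeightOneSpectrum (𝓞 K), Sum.inl v ∈ S ∧ w.asIdeal.LiesOver v.asIdeal}

variable (L) in
/-- The group `E_{L,S}^T` of `S(L)`-units of `L` which are congruent to `1` modulo every prime of
`L` above a place in `T`. -/
def unitsCongr (S : Set (Place K)) (T : Finset (HeightOneSpectrum (𝓞 K))) : Set Lˣ :=
  {x | x ∈ (finitePlacesAbove L S).unit L ∧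
    ∀ v ∈ T, ∀ w : HeightOneSpectrum (𝓞 L), w.asIdeal.LiesOver v.asIdeal →
      w.valuation L ((x : L) - 1) < 1}

variable (L) in
/-- The hypothesis `Hyp(S, T)`. -/
structure Hyp (S : Set (Place K)) (T : Finset (HeightOneSpectrum (𝓞 K))) : Prop where
  subset : ramifiedPlaces K L ∪ archimedeanPlaces K ⊆ S
  disjoint : ∀ v ∈ T, Sum.inl v ∉ S
  torsionfree : ∀ x ∈ unitsCongr L S T, IsOfFinOrder x → x = 1

variable (L) in
/-- The `ζ(ℤ[G])`-module `𝔄_S` generated by the `δ_T(0)`, where `Hyp(S, T)` is satisfied. -/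
def annihilatorModule [IsGalois K L] (S : Set (Place K)) :
    Submodule (intCenter Gal(L/K)) (MonoidAlgebra ℂ Gal(L/K)) :=
  Submodule.span _ {d | ∃ T : Finset (HeightOneSpectrum (𝓞 K)), Hyp L S T ∧ d = delta L T 0}

variable (K L) in
/-- `ω_L = nr(w_L)`, where `w_L = |μ_L|`. -/
def omega : MonoidAlgebra ℂ Gal(L/K) := nr ((Units.torsionOrder L : ℕ) : MonoidAlgebra ℂ Gal(L/K))

/-- The finite places `v` of `K` below a prime that occurs in the factorisation of `(ε)`. -/
def divisorPlaces (K : Type*) [Field K] [NumberField K] [Algebra K L] (ε : Lˣ) : Set (Place K) :=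
  Sum.inl '' {v | ∃ w : HeightOneSpectrum (𝓞 L),
    w.asIdeal.LiesOver v.asIdeal ∧ w.valuation L (ε : L) ≠ 1}

/-- `ε` is an anti-unit of the CM-field `L`, that is, `ε^{1+j} = 1`. -/
def IsAntiUnit [IsCMField L] (ε : Lˣ) : Prop :=
  (ε : L) * IsCMField.complexConj L (ε : L) = 1

/-- The action of the Galois group on `Lˣ`. -/
def actUnits (g : Gal(L/K)) : Lˣ →* Lˣ := Units.map (g : L →* L)

/-- The action of the Galois group on the group of non-zero fractional ideals of `L`. -/
def actIdeals (g : Gal(L/K)) : (FractionalIdeal (𝓞 L)⁰ L)ˣ →* (FractionalIdeal (𝓞 L)⁰ L)ˣ :=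
  Units.map (FractionalIdeal.ringEquivOfRingEquiv L L
    (MulSemiringAction.toRingEquiv Gal(L/K) (𝓞 L) g) :
      FractionalIdeal (𝓞 L)⁰ L →* FractionalIdeal (𝓞 L)⁰ L)

/-- `u ∈ ℤ[G]` annihilates the class group of `L`: for each non-zero fractional ideal `𝔞`, the
class of `𝔞^u` is trivial. -/
def AnnihilatesClassGroup (u : MonoidAlgebra ℤ Gal(L/K)) : Prop :=
  ∀ 𝔞 : (FractionalIdeal (𝓞 L)⁰ L)ˣ, ClassGroup.mk (K := L) (groupRingPow actIdeals 𝔞 u) = 1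

end Arithmetic

/-! ### The conjectures -/

section Conjectures

variable (K L : Type*) [Field K] [NumberField K] [Field L] [NumberField L] [Algebra K L]
  [IsGalois K L]

/-- For `X ⊆ ℂ[G]`: for each `x ∈ X`, one has `x 𝔄_S θ_S ⊆ Ann_{ζ(ℤ[G])}(cl_L)`. -/
def BrumerFor (X : Set (MonoidAlgebra ℂ Gal(L/K))) (S : Set (Place K)) : Prop :=
  ∃ θ : MonoidAlgebra ℂ Gal(L/K), IsStickelbergerElement S θ ∧
    ∀ x ∈ X, ∀ a ∈ annihilatorModule L S,
      ∃ u ∈ Subring.center (MonoidAlgebra ℤ Gal(L/K)),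
        intIncl Gal(L/K) u = x * (a * θ) ∧ AnnihilatesClassGroup u

/-- For `X ⊆ ℂ[G]`: for each `x ∈ X`, one has `x ω_L θ_S ∈ ζ(ℤ[G])`, and for each non-zero
fractional ideal `𝔞` there is an anti-unit `ε` with `𝔞^{x ω_L θ_S} = (ε)` such that, for each
finite set `T` of primes with `Hyp(S ∪ S_ε, T)`, there is `ε_T ∈ E_{L,S_ε}^T` with
`ε^{z δ_T(0)} = ε_T^{z ω_L}` for each `z ∈ X`. -/
def BrumerStarkFor [IsCMField L] (X : Set (MonoidAlgebra ℂ Gal(L/K))) (S : Set (Place K)) : Prop :=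
  ∃ θ : MonoidAlgebra ℂ Gal(L/K), IsStickelbergerElement S θ ∧
    ∀ x ∈ X, ∃ u ∈ Subring.center (MonoidAlgebra ℤ Gal(L/K)),
      intIncl Gal(L/K) u = x * (omega K L * θ) ∧
      ∀ 𝔞 : (FractionalIdeal (𝓞 L)⁰ L)ˣ, ∃ ε : Lˣ, IsAntiUnit ε ∧
        groupRingPow actIdeals 𝔞 u = toPrincipalIdeal (𝓞 L) L ε ∧
        ∀ T : Finset (HeightOneSpectrum (𝓞 K)), Hyp L (S ∪ divisorPlaces K ε) T →
          ∃ εT ∈ unitsCongr L (divisorPlaces K ε) T, ∀ z ∈ X,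
            ∃ y y' : MonoidAlgebra ℤ Gal(L/K),
              intIncl Gal(L/K) y = z * delta L T 0 ∧ intIncl Gal(L/K) y' = z * omega K L ∧
              groupRingPow actUnits ε y = groupRingPow actUnits εT y'

/-- The non-abelian Brumer conjecture `B(L/K,S)`. -/
def BrumerConjecture (S : Set (Place K)) : Prop :=
  BrumerFor K L (denominatorIdeal Gal(L/K)) S

/-- The non-abelian Brumer–Stark conjecture `BS(L/K,S)`. -/
def BrumerStarkConjecture [IsCMField L] (S : Set (Place K)) : Prop :=
  BrumerStarkFor K L (denominatorIdeal Gal(L/K)) S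

/-- The weak Brumer conjecture `B_w(L/K,S)`, formulated with the maximal order `𝔐`. -/
def WeakBrumerConjecture (𝔐 : Subring (MonoidAlgebra ℚ Gal(L/K))) (S : Set (Place K)) : Prop :=
  BrumerFor K L (centralConductor 𝔐) S

/-- The weak Brumer–Stark conjecture `BS_w(L/K,S)`, formulated with the maximal order `𝔐`. -/
def WeakBrumerStarkConjecture [IsCMField L] (𝔐 : Subring (MonoidAlgebra ℚ Gal(L/K)))
    (S : Set (Place K)) : Prop :=
  BrumerStarkFor K L (centralConductor 𝔐) S

end Conjectures

end BrumerStark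

end

/-! It suffices to add one place `v` to `S`; it is finite, since `S` contains the archimedean
places, and unramified, since `S` contains `S_ram`. Deleting its Euler factor multiplies `L_S(s,
χ̌)` by `det(1 - N(v)^{-s} φ_w⁻¹ | V_χ)`, so at `s = 0` the Stickelberger element is multiplied by
`nr(a)` with `a = 1 - φ_w⁻¹ ∈ ℤ[G]`. Everything then rests on the set `X` of multipliers, `𝓗(G)` or
`𝓕(G)`, being stable under `nr(a)`: the claim for `x` and the larger set is the claim for `x nr(a)`
and `S`. The other data depend on `S` only through `Hyp`, which is inherited by smaller sets.

Stability of `𝓗(G)` (`denominatorIdeal_mul_nr`) comes from `nr(a) H* = D (H D)*` with `D = diag(a,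
1, …, 1)`, where `H D` is again integral. Stability of `𝓕(G)` (`centralConductor_mul_nr`) requires
`nr(a)` to lie in the maximal order. It is central and integral over `ℤ`; since it is defined
through `ℂ[G]`, its rationality needs a proof, which uses character sums and Newton's identities
(`nr_ratIncl_mem`). -/

noncomputable section

/-! ### Eigenvalues, integrality of determinants, Newton's identities -/

section Eigenvalues

open Polynomial

namespace Matrix

variable {n K : Type*} [Fintype n] [DecidableEq n] [Field K] [IsAlgClosed K]

theorem card_roots_charpoly (A : Matrix n n K) :
    Multiset.card A.charpoly.roots = Fintype.card n := by
  rw [← A.charpoly_natDegree_eq_dim, (IsAlgClosed.splits A.charpoly).natDegree_eq_card_roots]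

/-- Both sides are multiplicative in `p`, which splits; for a linear factor `X - a` this is the
characteristic polynomial evaluated at `a`. -/
theorem det_aeval_eq_prod_roots_charpoly (A : Matrix n n K) (p : K[X]) :
    (aeval A p).det = (A.charpoly.roots.map p.eval).prod := by
  have key : ∀ s : Multiset K, (aeval A (s.map fun a => X - C a).prod).det =
      (A.charpoly.roots.map (s.map fun a => X - C a).prod.eval).prod := by
    intro s
    induction s using Multiset.induction_on with
    | empty => simp
    | cons a s ih =>
      simp only [Multiset.map_cons, Multiset.prod_cons, map_mul, Matrix.det_mul, ih, eval_mul,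
        Multiset.prod_map_mul]
      congr 1
      have h := A.eval_charpoly a
      rw [(IsAlgClosed.splits A.charpoly).eq_prod_roots_of_monic A.charpoly_monic,
        eval_multiset_prod, Multiset.map_map] at h
      have h1 : aeval A (X - C a) = -(scalar n a - A) := by
        simp [Matrix.algebraMap_eq_diagonal, Pi.algebraMap_def]
      have h2 : A.charpoly.roots.map (eval · (X - C a)) =
          (A.charpoly.roots.map (eval a ∘ fun b => X - C b)).map Neg.neg := by
        rw [Multiset.map_map]
        exact Multiset.map_congr rfl fun b _ => by simp
      -- The signs agree because there are as many roots as rows.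
      rw [h1, det_neg, ← h, h2, Multiset.prod_map_neg, Multiset.card_map, card_roots_charpoly]
  rw [(IsAlgClosed.splits p).eq_prod_roots, map_mul, det_mul, key, aeval_C]
  simp only [eval_mul, Multiset.prod_map_mul, eval_C, Multiset.map_const', Multiset.prod_replicate,
    card_roots_charpoly]
  congr 1
  simp [Matrix.algebraMap_eq_diagonal, Pi.algebraMap_def]

/-- Apply the product formula to the polynomial `t - X ^ k` for every `t`. -/
theorem roots_charpoly_pow (A : Matrix n n K) (k : ℕ) :
    (A ^ k).charpoly.roots = A.charpoly.roots.map (· ^ k) := by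
  suffices (A ^ k).charpoly = ((A.charpoly.roots.map (· ^ k)).map fun a => X - C a).prod by
    rw [this, roots_multiset_prod_X_sub_C]
  refine Polynomial.funext fun t => ?_
  have := det_aeval_eq_prod_roots_charpoly A (C t - X ^ k)
  rw [eval_charpoly, eval_multiset_prod, Multiset.map_map, Multiset.map_map]
  refine (congr_arg det ?_).trans (this.trans
    (congr_arg Multiset.prod (Multiset.map_congr rfl fun b _ => ?_)))
  · simp [Matrix.algebraMap_eq_diagonal, Pi.algebraMap_def]
  · simp

theorem trace_pow_eq_sum_roots_charpoly (A : Matrix n n K) (k : ℕ) :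
    (A ^ k).trace = (A.charpoly.roots.map (· ^ k)).sum := by
  rw [trace_eq_sum_roots_charpoly, roots_charpoly_pow]

/-- The determinant of an integral matrix is integral. -/
theorem isIntegral_det {R : Type*} [CommRing R] [Algebra R K] {A : Matrix n n K}
    (hA : IsIntegral R A) : IsIntegral R A.det := by
  obtain ⟨p, hp, hpA⟩ := hA
  rw [det_eq_prod_roots_charpoly]
  refine IsIntegral.multiset_prod fun a ha => ⟨p, hp, ?_⟩
  -- By spectral mapping, every eigenvalue is a root of the monic polynomial that kills `A`.
  have ha := mem_spectrum_of_isRoot_charpoly (isRoot_of_mem_roots ha)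
  have hmem := spectrum.subset_polynomial_aeval A (p.map (algebraMap R K)) ⟨a, ha, rfl⟩
  rw [aeval_map_algebraMap, aeval_def, hpA] at hmem
  rcases isEmpty_or_nonempty n with h | h
  · exact (spectrum.mem_iff.1 ha (isUnit_of_subsingleton _)).elim
  · rw [spectrum.zero_eq, Set.mem_singleton_iff] at hmem
    exact (eval_map _ _).symm.trans hmem

/-- `1 - uM` divides `1 - u ^ k` by the geometric sum, and `|u| < 1` excludes `u ^ k = 1`. This
makes Euler factors invertible. -/
theorem det_one_sub_smul_ne_zero {M : Matrix n n ℂ} {k : ℕ} (hk : k ≠ 0) (hM : M ^ k = 1) {u : ℂ}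
    (hu : ‖u‖ < 1) : (1 - u • M).det ≠ 0 := by
  intro h
  have h1 := congr_arg Matrix.det (mul_neg_geom_sum (u • M) k)
  have h2 : (1 : Matrix n n ℂ) - u ^ k • 1 = (1 - u ^ k) • 1 := by rw [sub_smul, one_smul]
  rw [Matrix.det_mul, h, zero_mul, _root_.smul_pow, hM, h2, Matrix.det_smul,
    Matrix.det_one, mul_one] at h1
  have h3 : u ^ k = 1 := (sub_eq_zero.1 (eq_zero_of_pow_eq_zero h1.symm)).symm
  have h4 : ‖u‖ ^ k < 1 := pow_lt_one₀ (norm_nonneg _) hu hk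
  rw [← norm_pow, h3, norm_one] at h4
  exact lt_irrefl _ h4

end Matrix

theorem Multiset.mul_esymm_eq_sum {K : Type*} [CommRing K] (s : Multiset K) (k : ℕ) :
    k * s.esymm k = (-1) ^ (k + 1) * ∑ a ∈ Finset.HasAntidiagonal.antidiagonal k with a.1 < k,
      (-1) ^ a.1 * s.esymm a.1 * (s.map (· ^ a.2)).sum := by
  obtain ⟨l, rfl⟩ : ∃ l : List K, (l : Multiset K) = s := Quot.exists_rep s
  have h := congr_arg (MvPolynomial.aeval l.get)
    (MvPolynomial.mul_esymm_eq_sum (Fin l.length) K k)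
  have hl : Multiset.map l.get Finset.univ.val = (l : Multiset K) := by
    rw [Fin.univ_val_map, List.ofFn_get]
  have hp : ∀ m, MvPolynomial.aeval l.get (MvPolynomial.psum (Fin l.length) K m) =
      ((l : Multiset K).map (· ^ m)).sum := fun m => by
    rw [← hl, Multiset.map_map]
    simp only [MvPolynomial.psum, map_sum, map_pow, MvPolynomial.aeval_X]
    rfl
  simpa only [map_mul, map_natCast, map_pow, map_neg, map_one, map_sum,
    MvPolynomial.aeval_esymm_eq_multiset_esymm, hp, hl] using h

/-- The product of the monic polynomials of the components kills the whole family. -/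
theorem Pi.isIntegral {R ι : Type*} {A : ι → Type*} [Finite ι] [CommRing R] [∀ i, Ring (A i)]
    [∀ i, Algebra R (A i)] {c : ∀ i, A i} (hc : ∀ i, IsIntegral R (c i)) : IsIntegral R c := by
  have := Fintype.ofFinite ι
  choose p hp hpc using hc
  refine ⟨∏ i, p i, monic_prod_of_monic _ _ fun i _ => hp i, funext fun i => ?_⟩
  have h := aeval_algHom_apply (Pi.evalAlgHom R A i) c (∏ i, p i)
  rw [← aeval_def]
  refine h.symm.trans ?_
  obtain ⟨q, hq⟩ := Finset.dvd_prod_of_mem p (Finset.mem_univ i)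
  have h0 : aeval (Pi.evalAlgHom R A i c) (p i) = 0 := hpc i
  rw [hq, map_mul, h0, zero_mul, Pi.zero_apply]

end Eigenvalues

namespace BrumerStark

/-! ### Reduced norms, generalised adjoints and stability of the denominator ideal -/

section Algebra

variable {G : Type*} [Group G] [Finite G]

instance (χ : Irr G) : NeZero χ.degree := (wedderburn G).dim_ne_zero χ

theorem Irr.proj_apply (χ : Irr G) (x : MonoidAlgebra ℂ G) :
    χ.proj x = (wedderburn G).iso x χ := rfl

theorem Irr.proj_iso_symm (χ : Irr G)
    (f : (χ : Irr G) → Matrix (Fin ((wedderburn G).dim χ)) (Fin ((wedderburn G).dim χ)) ℂ) :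
    χ.proj ((wedderburn G).iso.symm f) = f χ := by
  rw [Irr.proj_apply, AlgEquiv.apply_symm_apply]

theorem Irr.proj_surjective (χ : Irr G) : Function.Surjective χ.proj := fun B =>
  ⟨(wedderburn G).iso.symm (Pi.single χ B), by rw [Irr.proj_iso_symm]; simp⟩

theorem ext_proj {x y : MonoidAlgebra ℂ G} (h : ∀ χ : Irr G, χ.proj x = χ.proj y) : x = y :=
  (wedderburn G).iso.injective (funext h)

theorem Irr.proj_centralElement (χ : Irr G) (c : Irr G → ℂ) :
    χ.proj (centralElement c) = Matrix.scalar (Fin χ.degree) (c χ) :=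
  χ.proj_iso_symm _

theorem commute_centralElement (c : Irr G → ℂ) (x : MonoidAlgebra ℂ G) :
    Commute (centralElement c) x :=
  ext_proj fun χ => by
    rw [map_mul, map_mul, χ.proj_centralElement]
    exact Matrix.scalar_commute _ (fun r => Commute.all _ _) _

theorem centralElement_mul (c d : Irr G → ℂ) :
    centralElement (c * d) = centralElement c * centralElement d :=
  ext_proj fun χ => by simp [χ.proj_centralElement]

variable (G) in
/-- The isomorphism of `∏_χ ℂ` with the centre of `ℂ[G]`, as an embedding into `ℂ[G]`. -/
def centralElementHom : (Irr G → ℂ) →ₐ[ℂ] MonoidAlgebra ℂ G :=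
  AlgHom.ofLinearMap
    { toFun := centralElement
      map_add' := fun c d => ext_proj fun χ => by simp [χ.proj_centralElement]
      map_smul' := fun r c => ext_proj fun χ => by
        simp [χ.proj_centralElement, Matrix.smul_eq_diagonal_mul] }
    (ext_proj fun χ => by
      change χ.proj (centralElement 1) = _
      simp [χ.proj_centralElement])
    centralElement_mul

theorem centralElementHom_apply (c : Irr G → ℂ) : centralElementHom G c = centralElement c := rfl

/-- The ring homomorphism `M_n(ℂ[G]) → M_{n χ(1)}(ℂ)`. -/
def componentHom (χ : Irr G) (n : ℕ) : Matrix (Fin n) (Fin n) (MonoidAlgebra ℂ G) →+*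
    Matrix (Fin n × Fin χ.degree) (Fin n × Fin χ.degree) ℂ :=
  (Matrix.compRingEquiv (Fin n) (Fin χ.degree) ℂ).toRingHom.comp χ.proj.toRingHom.mapMatrix

theorem component_mul (χ : Irr G) {n : ℕ} (H H' : Matrix (Fin n) (Fin n) (MonoidAlgebra ℂ G)) :
    component χ (H * H') = component χ H * component χ H' :=
  map_mul (componentHom χ n) H H'

theorem component_apply (χ : Irr G) {n : ℕ} (H : Matrix (Fin n) (Fin n) (MonoidAlgebra ℂ G))
    (i j : Fin n × Fin χ.degree) : component χ H i j = χ.proj (H i.1 j.1) i.2 j.2 := rfl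

theorem ext_component {n : ℕ} {H H' : Matrix (Fin n) (Fin n) (MonoidAlgebra ℂ G)}
    (h : ∀ χ : Irr G, component χ H = component χ H') : H = H' := by
  ext1 i j
  refine ext_proj fun χ => ?_
  ext k l
  exact congr_fun (congr_fun (h χ) (i, k)) (j, l)

theorem component_genAdjoint (χ : Irr G) {n : ℕ}
    (H : Matrix (Fin n) (Fin n) (MonoidAlgebra ℂ G)) :
    component χ (genAdjoint H) = (component χ H).adjugate := by
  ext i j
  rw [component_apply, genAdjoint, Matrix.of_apply, χ.proj_iso_symm]
  rfl

theorem det_component_diagonal (χ : Irr G) {n : ℕ} (d : Fin n → MonoidAlgebra ℂ G) :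
    (component χ (Matrix.diagonal d)).det = ∏ i, (χ.proj (d i)).det := by
  rw [← Matrix.det_blockDiagonal, ← Matrix.det_reindex_self (Equiv.prodComm _ _)]
  congr 1
  ext ⟨k, i⟩ ⟨l, j⟩
  simp only [Matrix.reindex_apply, Matrix.submatrix_apply, Equiv.prodComm_symm,
    Equiv.prodComm_apply, Prod.swap_prod_mk, component_apply, Matrix.blockDiagonal_apply]
  by_cases h : i = j <;> simp [h]

theorem nr_eq (x : MonoidAlgebra ℂ G) : nr x = centralElement fun χ => (χ.proj x).det := by
  simp [nr, nrMatrix, det_component_diagonal]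

theorem Irr.proj_nr (χ : Irr G) (x : MonoidAlgebra ℂ G) :
    χ.proj (nr x) = Matrix.scalar _ (χ.proj x).det := by
  rw [nr_eq, χ.proj_centralElement]

/-- With `D = diag(x, 1, …, 1)` one has `nr(x) H* = D (H D)*`. -/
theorem nr_smul_genAdjoint {n : ℕ} (x : MonoidAlgebra ℂ G)
    (H : Matrix (Fin (n + 1)) (Fin (n + 1)) (MonoidAlgebra ℂ G)) :
    nr x • genAdjoint H = Matrix.diagonal (Fin.cons x 1) *
      genAdjoint (H * Matrix.diagonal (Fin.cons x 1)) := by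
  refine ext_component fun χ => ?_
  have key : component χ (nr x • genAdjoint H) =
      (χ.proj x).det • component χ (genAdjoint H) := by
    ext i j
    simp [component_apply, χ.proj_nr]
  -- Adjugates reverse products, so `D (H D)*` becomes `D adj(D) adj(H) = det(D) adj(H)`.
  rw [key, component_mul, component_genAdjoint, component_genAdjoint, component_mul,
    Matrix.adjugate_mul_distrib, ← mul_assoc, Matrix.mul_adjugate, det_component_diagonal,
    Fin.prod_univ_succ]
  simp

omit [Finite G] in
variable (G) in
theorem intIncl_injective : Function.Injective (intIncl G) :=
  MonoidAlgebra.map_injective (Int.castRingHom ℂ : ℤ →+ ℂ) Int.cast_injective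

omit [Finite G] in
theorem mem_intCenter_of_forall_commute {x : MonoidAlgebra ℂ G} (hx : x ∈ (intIncl G).range)
    (hc : ∀ y, Commute x y) : x ∈ intCenter G := by
  obtain ⟨y, rfl⟩ := hx
  refine ⟨y, Subring.mem_center_iff.2 fun z => intIncl_injective G ?_, rfl⟩
  rw [map_mul, map_mul, (hc _).eq]

omit [Finite G] in
-- The group elements lie in `ℤ[G]` and span `ℂ[G]`.
theorem commute_of_mem_intCenter {x : MonoidAlgebra ℂ G} (hx : x ∈ intCenter G)
    (y : MonoidAlgebra ℂ G) : Commute x y := by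
  obtain ⟨z, hz, rfl⟩ := hx
  induction y using MonoidAlgebra.induction_on with
  | of g =>
    have := congr_arg (intIncl G) (Subring.mem_center_iff.1 hz (MonoidAlgebra.of ℤ G g))
    rw [map_mul, map_mul] at this
    have h : intIncl G (MonoidAlgebra.of ℤ G g) = MonoidAlgebra.of ℂ G g := by
      simp [intIncl, MonoidAlgebra.of_apply]
    rw [h] at this
    exact this.symm
  | add f g hf hg => exact hf.add_right hg
  | smul r f hf => exact hf.smul_right r

theorem denominatorIdeal_mul_nr {x : MonoidAlgebra ℂ G} (hx : x ∈ denominatorIdeal G)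
    (a : MonoidAlgebra ℤ G) : x * nr (intIncl G a) ∈ denominatorIdeal G := by
  obtain ⟨hxc, hx⟩ := hx
  have hcomm := commute_of_mem_intCenter hxc
  have key : ∀ (n : ℕ) (H : Matrix (Fin n) (Fin n) (MonoidAlgebra ℤ G)) (i j : Fin n),
      x * nr (intIncl G a) * genAdjoint (H.map (intIncl G)) i j ∈ (intIncl G).range := by
    rintro (_ | n) H i j
    · exact i.elim0
    set d : Fin (n + 1) → MonoidAlgebra ℤ G := Fin.cons a 1 with hd
    have hdm : (Matrix.diagonal d).map (intIncl G) =
        Matrix.diagonal (Fin.cons (intIncl G a) 1) := by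
      rw [Matrix.diagonal_map (map_zero _)]
      congr 1
      funext k
      refine Fin.cases ?_ (fun k => ?_) k <;> simp [hd]
    have h := congr_fun (congr_fun (nr_smul_genAdjoint (intIncl G a) (H.map (intIncl G))) i) j
    rw [Matrix.smul_apply, smul_eq_mul, ← hdm, ← Matrix.map_mul, Matrix.diagonal_map (map_zero _),
      Matrix.diagonal_mul] at h
    -- As `x` is central, it moves past the integral entry `d i` to meet the adjoint of the integral
    -- matrix `H D`.
    rw [mul_assoc, h, ← mul_assoc, (hcomm _).eq, mul_assoc]
    exact mul_mem ⟨d i, rfl⟩ (hx _ _ _ _)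
  refine ⟨mem_intCenter_of_forall_commute ?_ fun y => ?_, key⟩
  -- Integrality of `x nr(a)` itself is the case of the `1 × 1` identity matrix, which is its own
  -- adjoint.
  · have h := key 1 1 0 0
    suffices genAdjoint ((1 : Matrix (Fin 1) (Fin 1) (MonoidAlgebra ℤ G)).map (intIncl G)) = 1 by
      rwa [this, Matrix.one_apply_eq, mul_one] at h
    refine ext_component fun χ => ?_
    rw [component_genAdjoint, Matrix.map_one _ (map_zero _) (map_one _)]
    have : component χ (1 : Matrix (Fin 1) (Fin 1) (MonoidAlgebra ℂ G)) = 1 :=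
      map_one (componentHom χ 1)
    rw [this, Matrix.adjugate_one]
  · rw [nr_eq]
    exact (hcomm y).mul_left (commute_centralElement _ y)

end Algebra

/-! ### Rationality and integrality of reduced norms; stability of the central conductor -/

section Rationality

variable {G : Type*} [Group G] [Finite G]

omit [Finite G] in
theorem ratIncl_of (g : G) : ratIncl G (MonoidAlgebra.of ℚ G g) = MonoidAlgebra.of ℂ G g := by
  simp [ratIncl, MonoidAlgebra.of_apply]

omit [Finite G] in
variable (G) in
theorem ratIncl_injective : Function.Injective (ratIncl G) :=
  MonoidAlgebra.map_injective (algebraMap ℚ ℂ : ℚ →+ ℂ) (algebraMap ℚ ℂ).injective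

omit [Finite G] in
theorem ratIncl_intInclRat (a : MonoidAlgebra ℤ G) :
    ratIncl G (intInclRat G a) = intIncl G a := by
  ext g
  simp [ratIncl, intInclRat, intIncl, MonoidAlgebra.coeff_mapRingHom]

variable (G) in
/-- The `ℚ`-algebra of families `(c_χ)_χ` which lie in the centre of `ℚ[G]`. -/
def rationalFamilies : Subalgebra ℚ (Irr G → ℂ) where
  __ := (ratIncl G).range.toSubsemiring.comap (centralElementHom G : (Irr G → ℂ) →+* _)
  algebraMap_mem' q := by
    refine ⟨algebraMap ℚ _ q, ?_⟩
    have h := (centralElementHom G).commutes (algebraMap ℚ ℂ q)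
    refine Eq.trans ?_ h.symm
    simp [ratIncl, MonoidAlgebra.coe_algebraMap]

theorem mem_rationalFamilies {c : Irr G → ℂ} :
    c ∈ rationalFamilies G ↔ centralElement c ∈ (ratIncl G).range := Iff.rfl

/-- The sum is invariant under conjugation, hence central and scalar in each component; the trace
determines the scalar. -/
theorem sum_conj_eq [Fintype G] (x : MonoidAlgebra ℂ G) :
    ∑ g : G, MonoidAlgebra.of ℂ G g * x * MonoidAlgebra.of ℂ G g⁻¹ =
      centralElement fun χ => Fintype.card G * (χ.proj x).trace / χ.degree := by
  set z := ∑ g : G, MonoidAlgebra.of ℂ G g * x * MonoidAlgebra.of ℂ G g⁻¹ with hz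
  have hcomm : ∀ y, Commute z y := fun y => by
    induction y using MonoidAlgebra.induction_on with
    | of h =>
      rw [Commute, SemiconjBy, hz, Finset.sum_mul, Finset.mul_sum,
        ← Equiv.sum_comp (Equiv.mulLeft h)]
      refine Finset.sum_congr rfl fun g _ => ?_
      simp only [Equiv.coe_mulLeft, mul_inv_rev, map_mul, mul_assoc]
      rw [← map_mul _ h⁻¹, inv_mul_cancel, map_one, mul_one]
    | add f g hf hg => exact hf.add_right hg
    | smul r f hf => exact hf.smul_right r
  refine ext_proj fun χ => ?_
  have hmem : χ.proj z ∈ Set.center (Matrix (Fin χ.degree) (Fin χ.degree) ℂ) := by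
    refine Semigroup.mem_center_iff.2 fun B => ?_
    obtain ⟨y, rfl⟩ := χ.proj_surjective B
    exact ((hcomm y).map χ.proj).symm
  rw [Matrix.center_eq_range] at hmem
  obtain ⟨t, ht⟩ := hmem
  have htr : (χ.proj z).trace = Fintype.card G * (χ.proj x).trace := by
    simp only [hz, map_sum, Matrix.trace_sum, map_mul]
    rw [Finset.sum_congr rfl fun g _ => ?_, Finset.sum_const, nsmul_eq_mul, Finset.card_univ]
    rw [Matrix.trace_mul_comm, ← mul_assoc, ← map_mul χ.proj,
      ← map_mul (MonoidAlgebra.of ℂ G), inv_mul_cancel, map_one, map_one, one_mul]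
  rw [← ht, χ.proj_centralElement, ← htr, ← ht]
  congr 1
  have : (χ.degree : ℂ) ≠ 0 := NeZero.ne _
  simp [Matrix.trace, Matrix.scalar_apply]
  field_simp

/-- Schur orthogonality: average the conjugates of an element that projects to the matrix unit
`E_{il}` and read off the entry `(i, j)`. -/
theorem sum_trace_smul_eq [Fintype G] (χ : Irr G) :
    ∑ h : G, (χ.proj (MonoidAlgebra.of ℂ G h)).trace • χ.proj (MonoidAlgebra.of ℂ G h⁻¹) =
      Matrix.scalar _ (Fintype.card G / χ.degree : ℂ) := by
  ext l j
  have key : ∀ i : Fin χ.degree, ∑ h : G, χ.proj (MonoidAlgebra.of ℂ G h) i i *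
      χ.proj (MonoidAlgebra.of ℂ G h⁻¹) l j =
        if i = l ∧ i = j then (Fintype.card G / χ.degree : ℂ) else 0 := fun i => by
    obtain ⟨x, hx⟩ := χ.proj_surjective (Matrix.single i l 1)
    have h := congr_fun (congr_fun (congr_arg χ.proj (sum_conj_eq x)) i) j
    simp only [map_sum, map_mul, hx, χ.proj_centralElement, Matrix.sum_apply] at h
    convert! h using 1
    · refine Finset.sum_congr rfl fun g _ => ?_
      rw [Matrix.mul_assoc, Matrix.mul_apply, Finset.sum_eq_single i]
      · simp
      · intro b _ hb
        simp [Matrix.mul_apply, hb.symm]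
      · simp
    · by_cases h1 : i = l
      · subst h1
        by_cases h2 : i = j <;> simp [h2, Matrix.scalar_apply]
      · simp [h1, Matrix.scalar_apply]
  simp only [Matrix.sum_apply, Matrix.smul_apply, Matrix.trace, Matrix.diag_apply, smul_eq_mul,
    Finset.sum_mul]
  rw [Finset.sum_comm, Finset.sum_congr rfl fun i _ => key i]
  rw [Finset.sum_eq_single l (fun i _ hi => by simp [hi]) (by simp)]
  simp [Matrix.scalar_apply, Matrix.diagonal_apply]

theorem card_div_degree_sq_mem [Fintype G] :
    (fun χ : Irr G => ((Fintype.card G ^ 2 / χ.degree ^ 2 : ℚ) : ℂ)) ∈ rationalFamilies G := by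
  -- The witness is the sum of all commutators `g h g⁻¹ h⁻¹`. The inner sum acts as `|G| χ(h) /
  -- χ(1)`, and `∑ χ(h) h⁻¹` acts as `|G| / χ(1)`.
  refine ⟨∑ h : G, (∑ g : G, MonoidAlgebra.of ℚ G g * MonoidAlgebra.of ℚ G h *
    MonoidAlgebra.of ℚ G g⁻¹) * MonoidAlgebra.of ℚ G h⁻¹, ?_⟩
  refine ext_proj fun χ => ?_
  have key : ∀ h : G, χ.proj (∑ g : G, MonoidAlgebra.of ℂ G g * MonoidAlgebra.of ℂ G h *
      MonoidAlgebra.of ℂ G g⁻¹) * χ.proj (MonoidAlgebra.of ℂ G h⁻¹) =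
        (Fintype.card G / χ.degree : ℂ) •
          ((χ.proj (MonoidAlgebra.of ℂ G h)).trace • χ.proj (MonoidAlgebra.of ℂ G h⁻¹)) :=
    fun h => by
      rw [sum_conj_eq, χ.proj_centralElement, smul_smul]
      rw [Matrix.scalar_apply, ← Matrix.smul_eq_diagonal_mul, mul_div_right_comm]
  simp only [map_sum (ratIncl G), map_mul (ratIncl G), ratIncl_of]
  rw [map_sum]
  simp only [map_mul χ.proj, key]
  rw [← Finset.smul_sum, sum_trace_smul_eq]
  refine Eq.trans ?_ (χ.proj_centralElement _).symm
  ext i j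
  simp [Matrix.scalar_apply, Matrix.diagonal_apply]
  split_ifs <;> ring

/-- The rational numbers `|G|² / m²` separate the degrees `m`, so Lagrange interpolation writes any
rational function of the degree as a rational polynomial in the commutator sum. -/
theorem degree_family_mem (f : ℕ → ℚ) :
    (fun χ : Irr G => ((f χ.degree : ℚ) : ℂ)) ∈ rationalFamilies G := by
  have := Fintype.ofFinite G
  let s : Finset ℕ := Finset.univ.image (fun χ : Irr G => χ.degree)
  let v : ℕ → ℚ := fun m => (Fintype.card G ^ 2 / m ^ 2 : ℚ)
  have hv : Set.InjOn v s := by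
    intro a ha b hb hab
    have hpos : ∀ m ∈ s, (0 : ℚ) < m := fun m hm => by
      obtain ⟨χ, _, rfl⟩ := Finset.mem_image.1 hm
      exact_mod_cast NeZero.pos χ.degree
    have ha := hpos a ha
    have hb := hpos b hb
    have hG : (0 : ℚ) < Fintype.card G := by exact_mod_cast Fintype.card_pos
    have h1 : (a : ℚ) ^ 2 = b ^ 2 := by
      simp only [v] at hab
      field_simp at hab
      exact hab.symm
    exact_mod_cast (pow_left_inj₀ ha.le hb.le two_ne_zero).1 h1
  have h := Polynomial.aeval_mem_adjoin_singleton ℚ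
    (fun χ : Irr G => ((Fintype.card G ^ 2 / χ.degree ^ 2 : ℚ) : ℂ))
    (p := Lagrange.interpolate s v f)
  convert! Algebra.adjoin_le (Set.singleton_subset_iff.2 card_div_degree_sq_mem) h using 1
  funext χ
  have h1 := Polynomial.aeval_algHom_apply (Pi.evalAlgHom ℚ (fun _ : Irr G => ℂ) χ)
    (fun χ : Irr G => ((Fintype.card G ^ 2 / χ.degree ^ 2 : ℚ) : ℂ)) (Lagrange.interpolate s v f)
  refine Eq.trans ?_ h1
  change _ = Polynomial.aeval (algebraMap ℚ ℂ (v χ.degree)) _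
  rw [Polynomial.aeval_algebraMap_apply, Polynomial.coe_aeval_eq_eval,
    Lagrange.eval_interpolate_at_node f hv (Finset.mem_image_of_mem _ (Finset.mem_univ χ))]
  rfl

/-- The sum of conjugates of `b` is rational; multiplying by `χ(1) / |G|` leaves the trace. -/
theorem trace_family_mem (b : MonoidAlgebra ℚ G) :
    (fun χ : Irr G => (χ.proj (ratIncl G b)).trace) ∈ rationalFamilies G := by
  have := Fintype.ofFinite G
  have h1 : (fun χ : Irr G => Fintype.card G * (χ.proj (ratIncl G b)).trace / χ.degree) ∈
      rationalFamilies G := by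
    rw [mem_rationalFamilies, ← sum_conj_eq]
    exact sum_mem fun g _ => mul_mem (mul_mem ⟨_, ratIncl_of g⟩ ⟨_, rfl⟩) ⟨_, ratIncl_of g⁻¹⟩
  have h2 := mul_mem (degree_family_mem (G := G) fun m => m / Fintype.card G) h1
  convert! h2 using 1
  funext χ
  have : (χ.degree : ℂ) ≠ 0 := NeZero.ne _
  have : (Fintype.card G : ℂ) ≠ 0 := by simp
  simp
  field_simp

/-- Newton's identities express elementary symmetric functions of the eigenvalues rationally in the
power sums, which are the traces of powers of `b`. -/
theorem esymm_family_mem (b : MonoidAlgebra ℚ G) (k : ℕ) :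
    (fun χ : Irr G => (χ.proj (ratIncl G b)).charpoly.roots.esymm k) ∈ rationalFamilies G := by
  induction k using Nat.strong_induction_on with
  | _ k ih =>
    rcases Nat.eq_zero_or_pos k with rfl | hk
    · convert! one_mem (rationalFamilies G) using 1
      funext χ
      simp [Multiset.esymm]
    · have h : (-1 : Irr G → ℂ) ^ (k + 1) * ∑ a ∈ Finset.HasAntidiagonal.antidiagonal k with a.1 < k,
          (-1) ^ a.1 * (fun χ : Irr G => (χ.proj (ratIncl G b)).charpoly.roots.esymm a.1) *
            (fun χ : Irr G => (χ.proj (ratIncl G (b ^ a.2))).trace) ∈ rationalFamilies G := by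
        have hneg : (-1 : Irr G → ℂ) ∈ rationalFamilies G := neg_mem (one_mem _)
        exact mul_mem (pow_mem hneg _) (sum_mem fun a ha => mul_mem (mul_mem (pow_mem hneg _)
          (ih _ (Finset.mem_filter.1 ha).2)) (trace_family_mem _))
      convert! (rationalFamilies G).smul_mem h (k : ℚ)⁻¹ using 1
      funext χ
      have hkc : (k : ℂ) ≠ 0 := by exact_mod_cast hk.ne'
      have := Multiset.mul_esymm_eq_sum (χ.proj (ratIncl G b)).charpoly.roots k
      simp only [Pi.smul_apply, Pi.mul_apply, Pi.pow_apply, Pi.neg_apply, Pi.one_apply,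
        Finset.sum_apply, map_pow, Matrix.trace_pow_eq_sum_roots_charpoly, ← this, Rat.smul_def]
      push_cast
      field_simp

theorem nr_ratIncl_mem (b : MonoidAlgebra ℚ G) : nr (ratIncl G b) ∈ (ratIncl G).range := by
  rw [nr_eq, ← mem_rationalFamilies]
  -- The determinant is the elementary symmetric function of index `χ(1)`. As this index varies with
  -- `χ`, the family is cut up by the indicators of `χ(1) = m`.
  have h := sum_mem (t := Finset.univ.image fun χ : Irr G => χ.degree) fun m (_ : m ∈ _) =>
    mul_mem (degree_family_mem (G := G) (Pi.single m 1)) (esymm_family_mem b m)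
  convert! h using 1
  funext χ
  rw [Finset.sum_apply, Finset.sum_eq_single χ.degree]
  · have hs : ∀ (s : Multiset ℂ) (n : ℕ), Multiset.card s = n → s.prod = s.esymm n := by
      rintro s _ rfl
      simp [Multiset.esymm]
    simp only [Pi.mul_apply, Pi.single_eq_same, Rat.cast_one, one_mul]
    rw [Matrix.det_eq_prod_roots_charpoly]
    exact hs _ _ ((Matrix.card_roots_charpoly _).trans (Fintype.card_fin _))
  · intro m _ hm
    simp [hm.symm]
  · simp

omit [Finite G] in
/-- A maximal order contains every integral element of the centre. -/
theorem IsMaximalOrderOver.mem_of_isIntegral {𝔐 : Subring (MonoidAlgebra ℚ G)}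
    (h𝔐 : IsMaximalOrderOver 𝔐) {r : MonoidAlgebra ℚ G} (hr : IsIntegral ℤ r)
    (hc : ∀ y, Commute r y) : r ∈ 𝔐 := by
  -- The lattice `𝔐 ℤ[r]` is a ring because `r` is central, and finitely generated because `r` is
  -- integral. It is thus an order containing `𝔐`, so maximality puts `r` in `𝔐`.
  let N : Submodule ℤ (MonoidAlgebra ℚ G) := 𝔐.toAddSubgroup.toIntSubmodule
  let A : Subalgebra ℤ (MonoidAlgebra ℚ G) := Algebra.adjoin ℤ {r}
  let P : Submodule ℤ (MonoidAlgebra ℚ G) := Subalgebra.toSubmodule A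
  have hA : A ≤ Subalgebra.center ℤ _ := Algebra.adjoin_le <| Set.singleton_subset_iff.2 <|
    Subalgebra.mem_center_iff.2 fun y => (hc y).symm.eq
  have hPN : P * N = N * P := Submodule.mul_comm_of_commute fun m hm n _ =>
    (Subalgebra.mem_center_iff.1 (hA hm) n).symm
  have hNN : N * N ≤ N := Submodule.mul_le.2 fun m hm n hn => 𝔐.mul_mem hm hn
  have hPP : P * P ≤ P := Submodule.mul_le.2 fun m hm n hn => A.mul_mem hm hn
  have hmul : N * P * (N * P) ≤ N * P := by
    rw [mul_assoc, ← mul_assoc P, hPN, mul_assoc N P P, ← mul_assoc]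
    exact mul_le_mul' hNN hPP
  have hN : ∀ m ∈ 𝔐, m ∈ N * P := fun m hm => by
    simpa using Submodule.mul_mem_mul (show m ∈ N from hm) (show 1 ∈ P from A.one_mem)
  let Λ : Subring (MonoidAlgebra ℚ G) :=
    { (N * P).toAddSubgroup with
      carrier := (N * P : Submodule ℤ (MonoidAlgebra ℚ G))
      mul_mem' := fun ha hb => hmul (Submodule.mul_mem_mul ha hb)
      one_mem' := hN 1 𝔐.one_mem }
  have hfg : (N * P).FG := by
    refine Submodule.FG.mul ?_ hr.fg_adjoin_singleton
    rw [Submodule.fg_iff_addSubgroup_fg]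
    exact h𝔐.maximal.prop.fg
  have hΛ : IsOrder Λ :=
    { fg := (Submodule.fg_iff_addSubgroup_fg _).1 hfg
      full := fun a => by
        obtain ⟨n, hn, hna⟩ := h𝔐.maximal.prop.full a
        exact ⟨n, hn, hN _ hna⟩ }
  refine h𝔐.maximal.le_of_ge hΛ hN ?_
  change r ∈ N * P
  simpa using Submodule.mul_mem_mul (show 1 ∈ N from 𝔐.one_mem)
    (show r ∈ P from Algebra.self_mem_adjoin_singleton ℤ r)

/-- `ℤ[G]` is finite over `ℤ`, so `a` is integral; so are its matrix components and their
determinants. -/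
theorem isIntegral_nr_intIncl (a : MonoidAlgebra ℤ G) : IsIntegral ℤ (nr (intIncl G a)) := by
  have ha : IsIntegral ℤ a := IsIntegral.of_finite ℤ a
  rw [nr_eq, ← centralElementHom_apply]
  exact map_isIntegral_int _ (Pi.isIntegral fun χ => Matrix.isIntegral_det
    (map_isIntegral_int χ.proj (map_isIntegral_int (intIncl G) ha)))

theorem centralConductor_mul_nr {𝔐 : Subring (MonoidAlgebra ℚ G)} (h𝔐 : IsMaximalOrderOver 𝔐)
    {x : MonoidAlgebra ℂ G} (hx : x ∈ centralConductor 𝔐) (a : MonoidAlgebra ℤ G) :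
    x * nr (intIncl G a) ∈ centralConductor 𝔐 := by
  obtain ⟨x, ⟨hx𝔐, hxc, hx⟩, rfl⟩ := hx
  obtain ⟨r, hr⟩ := nr_ratIncl_mem (intInclRat G a)
  rw [ratIncl_intInclRat] at hr
  have hrc : ∀ y, Commute r y := fun y => ratIncl_injective G <| by
    rw [map_mul, map_mul, hr, nr_eq, (commute_centralElement _ _).eq]
  have hint : IsIntegral ℤ r :=
    (isIntegral_algHom_iff (ratIncl G).toIntAlgHom (ratIncl_injective G)).1 <| by
      change IsIntegral ℤ (ratIncl G r)
      rw [hr]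
      exact isIntegral_nr_intIncl a
  have hr𝔐 := h𝔐.mem_of_isIntegral hint hrc
  refine ⟨x * r, ⟨mul_mem hx𝔐 hr𝔐, fun m hm => ?_, fun m hm => ?_⟩, by rw [map_mul, hr]⟩
  · rw [mul_assoc, (hrc m).eq, ← mul_assoc, hxc m hm, mul_assoc]
  · rw [mul_assoc]
    exact hx _ (mul_mem hr𝔐 hm)

end Rationality

/-! ### Euler factors and the change of the Stickelberger element -/

section Arithmetic

variable {K L : Type*} [Field K] [NumberField K] [Field L] [NumberField L] [Algebra K L]

/-- The order of the inertia group is the ramification index. -/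
theorem inertiaGroup_eq_bot [IsGalois K L] {v : HeightOneSpectrum (𝓞 K)}
    (hv : Sum.inl v ∉ ramifiedPlaces K L) : inertiaGroup L v = ⊥ := by
  have hlies : (placeAbove L v).asIdeal.LiesOver v.asIdeal := (exists_placeAbove L v).choose_spec
  have hram : (placeAbove L v).asIdeal.ramificationIdx (𝓞 K) = 1 := by
    by_contra h
    exact hv (Or.inl ⟨v, ⟨_, hlies, h⟩, rfl⟩)
  have hcard := Ideal.card_inertia_eq_ramificationIdxIn (G := Gal(L/K)) v.asIdeal
    (placeAbove L v).asIdeal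
  rw [Ideal.ramificationIdxIn_eq_ramificationIdx v.asIdeal (placeAbove L v).asIdeal Gal(L/K),
    hram, Subgroup.card_eq_one] at hcard
  refine (Subgroup.eq_bot_iff_forall _).2 fun σ hσ => Subtype.ext ?_
  have := Ideal.coe_mem_inertia.2 hσ
  rw [hcard] at this
  exact this

theorem detOnInertiaInvariants_eq {V : Type*} [AddCommGroup V] [Module ℂ V]
    (ρ : Representation ℂ Gal(L/K) V) {v : HeightOneSpectrum (𝓞 K)}
    (hv : inertiaGroup L v = ⊥) (σ : decompositionGroup L v) (u : ℂ) :
    detOnInertiaInvariants ρ v σ u = LinearMap.det (1 - u • ρ σ) := by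
  have htop : Representation.invariants
      ((ρ.comp (decompositionGroup L v).subtype).comp (inertiaGroup L v).subtype) = ⊤ := by
    refine eq_top_iff.2 fun x _ σ => ?_
    have : (σ : decompositionGroup L v) = 1 := (Subgroup.eq_bot_iff_forall _).1 hv _ σ.2
    simp [this]
  rw [detOnInertiaInvariants, ← LinearMap.det_conj _ (LinearEquiv.ofTop _ htop)]
  congr 1

/-- `ρ.dual g` is the transpose of `ρ g⁻¹`. This turns the Frobenius on the contragredient into its
inverse on `V_χ`. -/
theorem det_one_sub_smul_dual {G V : Type*} [Group G] [AddCommGroup V] [Module ℂ V]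
    [FiniteDimensional ℂ V] (ρ : Representation ℂ G V) (g : G) (u : ℂ) :
    LinearMap.det (1 - u • ρ.dual g) = LinearMap.det (1 - u • ρ g⁻¹) := by
  rw [← LinearMap.det_dualMap (1 - u • ρ g⁻¹)]
  congr 1
  ext f x
  simp only [LinearMap.dualMap_apply, LinearMap.sub_apply, LinearMap.smul_apply, map_sub, map_smul]
  rfl

theorem Irr.det_one_sub_smul_rep {G : Type*} [Group G] [Finite G] (χ : Irr G) (g : G) (u : ℂ) :
    LinearMap.det (1 - u • χ.rep g) = (1 - u • χ.proj (MonoidAlgebra.of ℂ G g)).det := by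
  rw [← LinearMap.det_toLin']
  congr 1
  rw [map_sub, map_smul, Matrix.toLin'_one]
  rfl

theorem one_lt_placeNorm (v : HeightOneSpectrum (𝓞 K)) : 1 < placeNorm v :=
  HeightOneSpectrum.one_lt_absNorm v

theorem norm_placeNorm_cpow_lt_one (v : HeightOneSpectrum (𝓞 K)) {s : ℂ} (hs : 0 < s.re) :
    ‖(placeNorm v : ℂ) ^ (-s)‖ < 1 := by
  have h := one_lt_placeNorm v
  rw [Complex.norm_natCast_cpow_of_pos (by omega)]
  exact Real.rpow_lt_one_of_one_lt_of_neg (by exact_mod_cast h) (by simpa)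

theorem analyticAt_det_one_sub_cpow_smul (v : HeightOneSpectrum (𝓞 K)) {n : Type*} [Fintype n]
    [DecidableEq n] (M : Matrix n n ℂ) (s : ℂ) :
    AnalyticAt ℂ (fun s : ℂ => (1 - (placeNorm v : ℂ) ^ (-s) • M).det) s := by
  have h : (placeNorm v : ℂ) ≠ 0 := by exact_mod_cast (zero_lt_one.trans (one_lt_placeNorm v)).ne'
  refine Differentiable.analyticAt (f := fun s : ℂ => (1 - (placeNorm v : ℂ) ^ (-s) • M).det) ?_ s
  simp only [Matrix.det_apply, Matrix.sub_apply, Matrix.smul_apply]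
  refine Differentiable.fun_sum fun σ _ => Differentiable.const_smul ?_ _
  refine Differentiable.fun_finsetProd fun i _ => ?_
  exact (differentiable_const _).sub ((differentiable_neg.const_cpow (Or.inl h)).smul_const _)

/-- Removing a non-zero factor from an infinite product. -/
theorem hasProd_subtype_insert {ι κ : Type*} {e : ι → κ} (he : Function.Injective e) {S : Set κ}
    {v : ι} (hv : e v ∉ S) {F : ι → ℂ} {a E : ℂ} (hE : E ≠ 0) (hF : F v = E⁻¹)
    (h : HasProd (fun i : {i // e i ∉ S} => F i) a) :
    HasProd (fun i : {i // e i ∉ insert (e v) S} => F i) (a * E) := by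
  classical
  have h1 : HasProd ({i | e i ∉ S}.mulIndicator F) a := hasProd_subtype_iff_mulIndicator.1 h
  refine (hasProd_subtype_iff_mulIndicator (s := {i | e i ∉ insert (e v) S})).2 ?_
  -- Multiply by the product supported at `v` with value `E`, which cancels `F v = E⁻¹`.
  convert! h1.mul (hasProd_ite_eq v E) using 1
  funext w
  by_cases hw : w = v
  · subst hw
    simp [Set.mulIndicator, hv, hE, hF]
  · simp [Set.mulIndicator, hw, he.eq_iff]

variable [IsGalois K L]

/-- Removing the Euler factor of an unramified place from an Artin `L`-function. -/
theorem IsArtinLFunction.insert {S : Set (Place K)} (hS : ramifiedPlaces K L ⊆ S)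
    {v : HeightOneSpectrum (𝓞 K)} (hv : Sum.inl v ∉ S) {χ : Irr Gal(L/K)} {f : ℂ → ℂ}
    (hf : IsArtinLFunction S χ.rep.dual f) :
    IsArtinLFunction (insert (Sum.inl v) S) χ.rep.dual fun s =>
      f s * (1 - (placeNorm v : ℂ) ^ (-s) • χ.proj
        (MonoidAlgebra.of ℂ _ (frobenius L v : Gal(L/K))⁻¹)).det := by
  have hfactor : ∀ s : ℂ, detOnInertiaInvariants χ.rep.dual v (frobenius L v)
      ((placeNorm v : ℂ) ^ (-s)) = (1 - (placeNorm v : ℂ) ^ (-s) • χ.proj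
        (MonoidAlgebra.of ℂ _ (frobenius L v : Gal(L/K))⁻¹)).det := fun s => by
    rw [detOnInertiaInvariants_eq _ (inertiaGroup_eq_bot fun h => hv (hS h)),
      det_one_sub_smul_dual, χ.det_one_sub_smul_rep]
  have hpow : χ.proj (MonoidAlgebra.of ℂ _ (frobenius L v : Gal(L/K))⁻¹) ^
      orderOf (frobenius L v : Gal(L/K))⁻¹ = 1 := by
    rw [← map_pow χ.proj, ← map_pow (MonoidAlgebra.of ℂ Gal(L/K)), pow_orderOf_eq_one, map_one,
      map_one]
  have hord : orderOf (frobenius L v : Gal(L/K))⁻¹ ≠ 0 := (orderOf_pos _).ne'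
  generalize χ.proj (MonoidAlgebra.of ℂ _ (frobenius L v : Gal(L/K))⁻¹) = M at *
  generalize orderOf (frobenius L v : Gal(L/K))⁻¹ = k at *
  have hmer : Meromorphic fun s : ℂ => (1 - (placeNorm v : ℂ) ^ (-s) • M).det := fun s =>
    (analyticAt_det_one_sub_cpow_smul v M s).meromorphicAt
  refine ⟨hf.meromorphic.mul hmer, fun s hs => ?_⟩
  have hne := Matrix.det_one_sub_smul_ne_zero hord hpow
    (norm_placeNorm_cpow_lt_one v (zero_lt_one.trans hs))
  exact hasProd_subtype_insert (F := fun v : HeightOneSpectrum (𝓞 K) =>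
      (detOnInertiaInvariants χ.rep.dual v (frobenius L v) ((placeNorm v : ℂ) ^ (-s)))⁻¹)
    Sum.inl_injective hv hne (congr_arg Inv.inv (hfactor s)) (hf.hasProd s hs)

/-- At `s = 0` one has `N(v)^{-s} = 1`, so the deleted factor is the component at `χ` of a reduced
norm from `ℤ[G]`. -/
theorem IsStickelbergerElement.insert {S : Set (Place K)} (hS : ramifiedPlaces K L ⊆ S)
    {v : HeightOneSpectrum (𝓞 K)} (hv : Sum.inl v ∉ S) {θ : MonoidAlgebra ℂ Gal(L/K)}
    (hθ : IsStickelbergerElement S θ) :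
    IsStickelbergerElement (insert (Sum.inl v) S)
      (nr (intIncl _ (1 - MonoidAlgebra.of ℤ _ (frobenius L v : Gal(L/K))⁻¹)) * θ) := by
  obtain ⟨c, rfl, hc⟩ := hθ
  rw [nr_eq, ← centralElement_mul]
  refine ⟨_, rfl, fun χ => ?_⟩
  obtain ⟨f, hf, hf0, hcf⟩ := hc χ
  refine ⟨_, hf.insert hS hv, hf0.mul (analyticAt_det_one_sub_cpow_smul _ _ 0), ?_⟩
  rw [Pi.mul_apply, hcf, mul_comm, map_sub, map_one, map_sub, map_one, neg_zero, Complex.cpow_zero,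
    one_smul]
  simp [intIncl]

end Arithmetic

/-! ### Passing from `S` to a larger set of places -/

section Conjectures

variable {K L : Type*} [Field K] [NumberField K] [Field L] [NumberField L] [Algebra K L]

theorem unitsCongr_mono {S S' : Set (Place K)} (h : S ⊆ S')
    (T : Finset (HeightOneSpectrum (𝓞 K))) : unitsCongr L S T ⊆ unitsCongr L S' T := by
  rintro x ⟨hx, hxT⟩
  refine ⟨fun w hw => hx w fun ⟨v, hv, hwv⟩ => hw ⟨v, h hv, hwv⟩, hxT⟩

/-- Enlarging `S` enlarges the unit group that has to be torsion-free and makes disjointness from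
`T` harder. -/
theorem Hyp.mono {S S' : Set (Place K)} {T : Finset (HeightOneSpectrum (𝓞 K))}
    (hS : ramifiedPlaces K L ∪ archimedeanPlaces K ⊆ S) (h : S ⊆ S') (hT : Hyp L S' T) :
    Hyp L S T :=
  ⟨hS, fun v hv hvS => hT.disjoint v hv (h hvS),
    fun x hx => hT.torsionfree x (unitsCongr_mono h T hx)⟩

variable [IsGalois K L]

theorem annihilatorModule_anti {S S' : Set (Place K)}
    (hS : ramifiedPlaces K L ∪ archimedeanPlaces K ⊆ S) (h : S ⊆ S') :
    annihilatorModule L S' ≤ annihilatorModule L S :=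
  Submodule.span_mono fun _ ⟨T, hT, hd⟩ => ⟨T, hT.mono hS h, hd⟩

variable {X : Set (MonoidAlgebra ℂ Gal(L/K))} {S : Set (Place K)}

/-- The hypothesis is used for `x nr(1 - φ_w⁻¹) ∈ X`; `𝔄` shrinks as `S` grows. -/
theorem BrumerFor.insert (hX : ∀ x ∈ X, ∀ a, x * nr (intIncl _ a) ∈ X)
    (hS : ramifiedPlaces K L ∪ archimedeanPlaces K ⊆ S) {v : HeightOneSpectrum (𝓞 K)}
    (hv : Sum.inl v ∉ S) (h : BrumerFor K L X S) : BrumerFor K L X (insert (Sum.inl v) S) := by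
  obtain ⟨θ, hθ, h⟩ := h
  refine ⟨_, hθ.insert (Set.subset_union_left.trans hS) hv, fun x hx a ha => ?_⟩
  obtain ⟨u, hu, hux, hann⟩ := h _ (hX x hx _) a
    (annihilatorModule_anti hS (Set.subset_insert _ _) ha)
  refine ⟨u, hu, hux.trans ?_, hann⟩
  rw [mul_assoc x, nr_eq, ← mul_assoc _ a θ, ← mul_assoc a, (commute_centralElement _ a).eq]

/-- The anti-unit obtained for `x nr(1 - φ_w⁻¹)` and `S` serves again: fewer `T` have to be treated,
and the conditions on `ε_T` do not involve `S`. -/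
theorem BrumerStarkFor.insert [IsCMField L] (hX : ∀ x ∈ X, ∀ a, x * nr (intIncl _ a) ∈ X)
    (hS : ramifiedPlaces K L ∪ archimedeanPlaces K ⊆ S) {v : HeightOneSpectrum (𝓞 K)}
    (hv : Sum.inl v ∉ S) (h : BrumerStarkFor K L X S) :
    BrumerStarkFor K L X (insert (Sum.inl v) S) := by
  obtain ⟨θ, hθ, h⟩ := h
  refine ⟨_, hθ.insert (Set.subset_union_left.trans hS) hv, fun x hx => ?_⟩
  obtain ⟨u, hu, hux, h⟩ := h _ (hX x hx _)
  refine ⟨u, hu, hux.trans ?_, fun 𝔞 => ?_⟩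
  · rw [mul_assoc x, nr_eq, ← mul_assoc _ _ θ, ← mul_assoc (omega K L),
      (commute_centralElement _ (omega K L)).eq]
  · obtain ⟨ε, hε, h𝔞, h⟩ := h 𝔞
    exact ⟨ε, hε, h𝔞, fun T hT => h T (hT.mono (hS.trans Set.subset_union_left)
      (Set.union_subset_union_left _ (Set.subset_insert _ _)))⟩

/-- A property of sets of places which is preserved when a finite place is added holds for all
larger finite sets. -/
theorem of_subset_of_insert {P : Set (Place K) → Prop} {S₀ S S' : Set (Place K)}
    (hinsert : ∀ (S : Set (Place K)) (v : HeightOneSpectrum (𝓞 K)), S₀ ⊆ S → Sum.inl v ∉ S →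
      P S → P (insert (Sum.inl v) S))
    (harch : archimedeanPlaces K ⊆ S₀) (hS : S₀ ⊆ S) (hSS' : S ⊆ S') (hS' : S'.Finite)
    (h : P S) : P S' := by
  suffices ∀ T : Set (Place K), T.Finite → P (S ∪ T) by
    rw [← Set.union_eq_self_of_subset_left hSS']
    exact this S' hS'
  intro T hT
  induction T, hT using Set.Finite.induction_on with
  | empty => rwa [Set.union_empty]
  | @insert v T _ _ ih =>
    rw [Set.union_insert]
    by_cases hv : v ∈ S ∪ T
    · rwa [Set.insert_eq_of_mem hv]
    · rcases v with v | v
      · exact hinsert _ v (hS.trans Set.subset_union_left) hv ih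
      -- An archimedean place is never new.
      · exact absurd (Or.inl (hS (harch ⟨v, rfl⟩))) hv

end Conjectures

end BrumerStark

end

theorem mainTheorem1 {K L : Type*} [Field K] [NumberField K] [Field L] [NumberField L]
    [Algebra K L] [IsGalois K L] [NumberField.IsTotallyReal K] [NumberField.IsCMField L]
    (S S' : Set (BrumerStark.Place K)) (hS : S.Finite) (hS' : S'.Finite)
    (hram : BrumerStark.ramifiedPlaces K L ∪ BrumerStark.archimedeanPlaces K ⊆ S)
    (hSS' : S ⊆ S') :
    (BrumerStark.BrumerConjecture K L S → BrumerStark.BrumerConjecture K L S') ∧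
    (BrumerStark.BrumerStarkConjecture K L S → BrumerStark.BrumerStarkConjecture K L S') ∧
    (∀ 𝔐 : Subring (MonoidAlgebra ℚ Gal(L/K)), BrumerStark.IsMaximalOrderOver 𝔐 →
      (BrumerStark.WeakBrumerConjecture K L 𝔐 S → BrumerStark.WeakBrumerConjecture K L 𝔐 S') ∧
      (BrumerStark.WeakBrumerStarkConjecture K L 𝔐 S →
        BrumerStark.WeakBrumerStarkConjecture K L 𝔐 S')) := by
  have harch := Set.subset_union_right (s := BrumerStark.ramifiedPlaces K L)
    (t := BrumerStark.archimedeanPlaces K)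
  have hB : ∀ X : Set (MonoidAlgebra ℂ Gal(L/K)),
      (∀ x ∈ X, ∀ a, x * BrumerStark.nr (BrumerStark.intIncl _ a) ∈ X) →
        BrumerStark.BrumerFor K L X S → BrumerStark.BrumerFor K L X S' := fun X hX =>
    BrumerStark.of_subset_of_insert (fun _ _ hS hv h => h.insert hX hS hv) harch hram hSS' hS'
  have hBS : ∀ X : Set (MonoidAlgebra ℂ Gal(L/K)),
      (∀ x ∈ X, ∀ a, x * BrumerStark.nr (BrumerStark.intIncl _ a) ∈ X) →
        BrumerStark.BrumerStarkFor K L X S → BrumerStark.BrumerStarkFor K L X S' := fun X hX =>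
    BrumerStark.of_subset_of_insert (fun _ _ hS hv h => h.insert hX hS hv) harch hram hSS' hS'
  exact ⟨hB _ fun _ hx => BrumerStark.denominatorIdeal_mul_nr hx,
    hBS _ fun _ hx => BrumerStark.denominatorIdeal_mul_nr hx,
    fun 𝔐 h𝔐 => ⟨hB _ fun _ hx => BrumerStark.centralConductor_mul_nr h𝔐 hx,
      hBS _ fun _ hx => BrumerStark.centralConductor_mul_nr h𝔐 hx⟩⟩
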